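/- Let $K$ be a field of characteristic $0$, let $R=K[[x_1,\dots,x_n]]$ and $S=K[[\lambda_1,\dots,\lambda_m]]$ be rings of formal power series ($n,m\ge 0$), and let $f\in R$. Write $R\hat\otimes S=K[[x,\lambda]]$. A deformation of $f$ over $S$ is a series $F\in K[[x,\lambda]]$ with $F(x,0)=f(x)$. A deformation $G\in K[[x,\alpha]]$ of $f$ over $T=K[[\alpha_1,\dots,\alpha_l]]$ is said to be induced from $F$ if there are homomorphisms of $K$-algebras $\varphi\colon K[[x,\lambda]]\to K[[x,\alpha]]$ and $\psi\colon K[[\lambda]]\to K[[\alpha]]$ such that $\varphi|_{K[[\lambda]]}=\psi$ (that is, $\varphi$ and $\psi$ commute with the inclusions $K[[\lambda]]\subset K[[x,\lambda]]$ and $K[[\alpha]]\subset K[[x,\alpha]]$) and $\varphi(F)=G$. The deformation $F$ of $f$ is called versal if every deformation $G$ of $f$, over a base $K[[\alpha_1,\dots,\alpha_l]]$ with any number $l\ge 0$ of parameters, can be induced from $F$. Let $J_f=(\partial f/\partial x_1,\dots,\partial f/\partial x_n)\subset R$ be the Jacobian ideal of $f$. Theorem. A deformation $F\in K[[x,\lambda]]$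 of $f\in R$ is versal if and only if the classes of the series $\frac{\partial F}{\partial \lambda_i}(x,0)$, $i=1,\dots,m$, generate the $K$-vector space $R/J_f$. -/

import Mathlib

namespace FormalDeformation

open MvPowerSeries

variable {K : Type*} [Field K]

/-- The inclusion `K[[λ]] → K[[x, λ]]` of the parameter ring `S = K[[λ₁, …, λₘ]]` in
`R ⊗̂ S = K[[x₁, …, xₙ, λ₁, …, λₘ]]`. The variables `x` are indexed by `Sum.inl` and the
parameters by `Sum.inr`. -/
noncomputable def paramIncl (K : Type*) [Field K] (n m : ℕ) :
    MvPowerSeries (Fin m) K →ₐ[K] MvPowerSeries (Fin n ⊕ Fin m) K :=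
  rename (Function.Embedding.inr : Fin m ↪ Fin n ⊕ Fin m)

/-- The restriction `F ↦ F(x, 0)` of `K[[x, λ]]` to `λ = 0`. -/
noncomputable def restrictZero (K : Type*) [Field K] (n m : ℕ) :
    MvPowerSeries (Fin n ⊕ Fin m) K →ₐ[K] MvPowerSeries (Fin n) K :=
  killCompl (Function.Embedding.inl : Fin n ↪ Fin n ⊕ Fin m)

/-- `F ∈ K[[x, λ]]` is a deformation of `f ∈ K[[x]]` over `K[[λ]]`. -/
def IsDeformation {n m : ℕ} (F : MvPowerSeries (Fin n ⊕ Fin m) K)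
    (f : MvPowerSeries (Fin n) K) : Prop :=
  restrictZero K n m F = f

/-- `G` (over `K[[α₁, …, αₗ]]`) is induced from `F` (over `K[[λ₁, …, λₘ]]`): there are
homomorphisms of `K`-algebras `φ : K[[x, λ]] → K[[x, α]]` and `ψ : K[[λ]] → K[[α]]` such that
`φ` restricts to `ψ` on the parameters, with `φ F = G`. -/
def IsInducedFrom {n m l : ℕ} (G : MvPowerSeries (Fin n ⊕ Fin l) K)
    (F : MvPowerSeries (Fin n ⊕ Fin m) K) : Prop :=
  ∃ (φ : MvPowerSeries (Fin n ⊕ Fin m) K →ₐ[K] MvPowerSeries (Fin n ⊕ Fin l) K)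
    (ψ : MvPowerSeries (Fin m) K →ₐ[K] MvPowerSeries (Fin l) K),
    φ.comp (paramIncl K n m) = (paramIncl K n l).comp ψ ∧ φ F = G

/-- The deformation `F` of `f` is versal: every deformation of `f`, over a ring of formal power
series in any finite number of parameters, can be induced from `F`. -/
def IsVersal {n m : ℕ} (F : MvPowerSeries (Fin n ⊕ Fin m) K)
    (f : MvPowerSeries (Fin n) K) : Prop :=
  IsDeformation F f ∧
    ∀ (l : ℕ) (G : MvPowerSeries (Fin n ⊕ Fin l) K), IsDeformation G f → IsInducedFrom G F

/-- The Jacobian ideal `J_f = (∂₁f, …, ∂ₙf)` of `K[[x₁, …, xₙ]]`. -/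
noncomputable def jacobianIdeal {n : ℕ} (f : MvPowerSeries (Fin n) K) :
    Ideal (MvPowerSeries (Fin n) K) :=
  Ideal.span (Set.range fun i : Fin n => pderiv K i f)

/-- The initial velocity `(∂F/∂λᵢ)(x, 0)` of a deformation. -/
noncomputable def initialVelocity {n m : ℕ} (F : MvPowerSeries (Fin n ⊕ Fin m) K) (i : Fin m) :
    MvPowerSeries (Fin n) K :=
  restrictZero K n m (pderiv K (Sum.inr i) F)

end FormalDeformation

/-! Write `R = K[[x]]`, `𝔪` for its maximal ideal, `J = J_f`, and `V` for the span of the initial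
velocities of `F`; the criterion says `R = V + J`.

Sufficiency is a successive approximation in powers of `(α)`. If `φ(F) = G` modulo `(α)^(k+1)`,
changing the images of `x` and `λ` by terms of order `k+1` changes `φ(F)` modulo `(α)^(k+2)` by a
combination of the `∂f/∂xᵢ` and the velocities (`algHom_taylor_mem`). Since `R = V + J`, any error
can be cancelled (`LiftPair.exists_improve`), and the limit of the corrections induces `G`.

Necessity compares velocities. If `G` is induced from `F` by `φ`, and `φ₀` is the endomorphism of
`R` obtained from `φ` at `α = 0`, the chain rule puts the velocities of `G` in `φ₀(V) + φ₀(J)R`.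
Nothing says that `φ₀` is an automorphism. Let `G` have all monomials of degree `< k+2` as
velocities. If `J ≠ R`, the variables among them force `φ₀` to be onto `𝔪/𝔪²`, hence bijective on
the finite-dimensional `R/𝔪^k`. Pulling back along `φ₀` gives `R = V + J + 𝔪^k`
(`mem_sup_varIdeal_pow`). As `V` is finite-dimensional, Nakayama's lemma removes `𝔪^k`
(`sup_eq_top_of_forall_sup_pow_eq_top`).

Homomorphisms are not assumed continuous; locality makes them so. -/

namespace FormalDeformation

open MvPowerSeries

/-! ### The maximal ideal of a power series ring and its adic topology -/

section VariableIdeal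

variable {σ τ K : Type*} [Field K]

/-- The ideal of `K[[X]]` generated by the variables. -/
noncomputable abbrev varIdeal (σ K : Type*) [Field K] : Ideal (MvPowerSeries σ K) :=
  Ideal.span (Set.range X)

theorem coeff_eq_zero_of_mem_varIdeal_pow {k : ℕ} {f : MvPowerSeries σ K}
    (hf : f ∈ varIdeal σ K ^ k) {d : σ →₀ ℕ} (hd : d.degree < k) : coeff d f = 0 := by
  suffices h : (k : ℕ∞) ≤ f.order from
    coeff_of_lt_order (lt_of_lt_of_le (by exact_mod_cast hd) h)
  clear hd d
  induction k generalizing f with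
  | zero => simp
  | succ k ih =>
    rw [pow_succ] at hf
    refine Submodule.mul_induction_on hf (fun a ha b hb => ?_)
      (fun a b ha hb => (le_min ha hb).trans min_order_le_add)
    refine le_trans ?_ le_order_mul
    push_cast
    refine add_le_add (ih ha) ?_
    rw [one_le_order_iff_constCoeff_eq_zero]
    have : varIdeal σ K ≤ RingHom.ker (constantCoeff (σ := σ) (R := K)) := by
      rw [Ideal.span_le]
      rintro _ ⟨i, rfl⟩
      simp
    exact this hb

variable [Finite σ] [Finite τ]

/-- The truncations are Cauchy for the powers of the ideal, and comparing coefficients identifies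
their adic limit with `f`. -/
theorem sub_truncTotal_mem_varIdeal_pow (f : MvPowerSeries σ K) (k : ℕ) :
    f - (truncTotal k f : MvPolynomial σ K) ∈ varIdeal σ K ^ k := by
  have hmap : ∀ {l : ℕ} {p : MvPolynomial σ K}, p ∈ MvPolynomial.idealOfVars σ K ^ l →
      (p : MvPowerSeries σ K) ∈ varIdeal σ K ^ l := by
    intro l p hp
    have := Ideal.mem_map_of_mem (MvPolynomial.coeToMvPowerSeries.ringHom (σ := σ) (R := K)) hp
    rw [Ideal.map_pow, Ideal.map_span, ← Set.range_comp] at this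
    have hX : MvPolynomial.coeToMvPowerSeries.ringHom ∘ MvPolynomial.X =
        (X : σ → MvPowerSeries σ K) := by
      ext1 i
      simp
    rwa [hX] at this
  obtain ⟨L, hL⟩ := IsPrecomplete.prec (I := varIdeal σ K) (M := MvPowerSeries σ K) inferInstance
    (f := fun k => (truncTotal k f : MvPolynomial σ K)) (fun {a b} hab => by
      rw [SModEq.sub_mem, smul_eq_mul, Ideal.mul_top]
      have := hmap (truncTotal_sub_truncTotal_mem_pow_idealOfVars le_rfl hab f)
      rwa [← MvPolynomial.coeToMvPowerSeries.ringHom_apply, map_sub] at this)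
  have hL' : ∀ k, (truncTotal k f : MvPowerSeries σ K) - L ∈ varIdeal σ K ^ k := by
    intro k
    have := hL k
    rwa [SModEq.sub_mem, smul_eq_mul, Ideal.mul_top] at this
  have : L = f := by
    ext d
    have h := coeff_eq_zero_of_mem_varIdeal_pow (hL' (d.degree + 1)) (Nat.lt_succ_self _)
    rw [map_sub, MvPolynomial.coeff_coe, coeff_truncTotal _ (Nat.lt_succ_self _)] at h
    exact (sub_eq_zero.mp h).symm
  rw [← this, ← neg_mem_iff, neg_sub]
  simpa [this] using hL' k

theorem mem_varIdeal_iff {f : MvPowerSeries σ K} : f ∈ varIdeal σ K ↔ constantCoeff f = 0 := by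
  constructor
  · intro h
    rw [← coeff_zero_eq_constantCoeff_apply]
    exact coeff_eq_zero_of_mem_varIdeal_pow (k := 1) (by simpa using h) (by simp)
  · intro h
    have h1 := sub_truncTotal_mem_varIdeal_pow f 1
    have : truncTotal 1 f = 0 := by
      ext d
      rw [coeff_truncTotal_eq_ite]
      split_ifs with hd
      · have : d = 0 := by rwa [Nat.lt_one_iff, Finsupp.degree_eq_zero_iff] at hd
        simpa [this] using h
      · simp
    simpa [this] using h1

theorem varIdeal_eq_maximalIdeal :
    varIdeal σ K = IsLocalRing.maximalIdeal (MvPowerSeries σ K) := by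
  ext f
  rw [mem_varIdeal_iff, IsLocalRing.mem_maximalIdeal, mem_nonunits_iff, isUnit_iff_constantCoeff,
    isUnit_iff_ne_zero, not_not]

/-- Homomorphisms of `K`-algebras between rings of formal power series are local. -/
theorem algHom_mem_varIdeal (φ : MvPowerSeries σ K →ₐ[K] MvPowerSeries τ K)
    {f : MvPowerSeries σ K} (hf : f ∈ varIdeal σ K) : φ f ∈ varIdeal τ K := by
  rw [mem_varIdeal_iff] at *
  by_contra hc
  -- If `φ f` had constant term `c ≠ 0`, the unit `f - c` would be sent to the non-unit `φ f - c`.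
  have hu : IsUnit (f - algebraMap K _ (constantCoeff (φ f))) := by
    rw [isUnit_iff_constantCoeff]
    simpa [hf, MvPowerSeries.algebraMap_apply] using hc
  have := hu.map φ
  rw [isUnit_iff_constantCoeff, map_sub, AlgHom.commutes] at this
  simp [MvPowerSeries.algebraMap_apply] at this

theorem algHom_mem_varIdeal_pow (φ : MvPowerSeries σ K →ₐ[K] MvPowerSeries τ K) {k : ℕ}
    {f : MvPowerSeries σ K} (hf : f ∈ varIdeal σ K ^ k) : φ f ∈ varIdeal τ K ^ k := by
  have h := Ideal.mem_map_of_mem φ hf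
  rw [Ideal.map_pow] at h
  refine Ideal.pow_right_mono ?_ k h
  rw [Ideal.map_le_iff_le_comap]
  exact fun a ha => algHom_mem_varIdeal φ ha

/-- Ideals of `K[[X]]` are closed in the adic topology. -/
theorem quotient_eq_zero_of_forall_mem_pow (N : Ideal (MvPowerSeries σ K))
    {c : MvPowerSeries σ K ⧸ N}
    (hc : ∀ k, c ∈ (varIdeal σ K).map (Ideal.Quotient.mk N) ^ k) : c = 0 := by
  refine IsHausdorff.haus (I := varIdeal σ K)
    (varIdeal_eq_maximalIdeal (σ := σ) (K := K) ▸ inferInstance) c (fun k => ?_)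
  rw [SModEq.zero, Ideal.smul_top_eq_map, Submodule.restrictScalars_mem, Ideal.map_pow]
  exact hc k

theorem mem_of_forall_mem_sup_pow (N : Ideal (MvPowerSeries σ K)) {f : MvPowerSeries σ K}
    (hf : ∀ k, f ∈ N ⊔ varIdeal σ K ^ k) : f ∈ N := by
  rw [← Ideal.Quotient.eq_zero_iff_mem]
  refine quotient_eq_zero_of_forall_mem_pow N fun k => ?_
  rw [← Ideal.map_pow]
  have := Ideal.mem_map_of_mem (Ideal.Quotient.mk N) (hf k)
  rwa [Ideal.map_sup, Ideal.map_quotient_self, bot_sup_eq] at this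

end VariableIdeal

/-! ### Homomorphisms and derivations are determined by the variables -/

section Uniqueness

variable {σ τ K : Type*} [Field K] [Finite σ] [Finite τ]

/-- A twisted derivation from `K[[X]]` to a separated algebra is determined by its values on the
variables. -/
theorem twistedDerivation_eq_zero {C : Type*} [CommRing C] [Algebra K C] (I : Ideal C)
    (hC : ∀ c : C, (∀ k, c ∈ I ^ k) → c = 0) (φ φ' : MvPowerSeries σ K →ₐ[K] C)
    (hφ : ∀ a ∈ varIdeal σ K, φ a ∈ I) (hφ' : ∀ a ∈ varIdeal σ K, φ' a ∈ I)
    (T : MvPowerSeries σ K →ₗ[K] C) (hT : ∀ a b, T (a * b) = φ a * T b + φ' b * T a)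
    (hX : ∀ i, T (X i) = 0) (f : MvPowerSeries σ K) : T f = 0 := by
  have h1 : T 1 = 0 := by simpa using hT 1 1
  have hpoly : ∀ p : MvPolynomial σ K, T p = 0 := by
    intro p
    induction p using MvPolynomial.induction_on with
    | C r =>
      rw [MvPolynomial.coe_C, ← mul_one (MvPowerSeries.C r), ← MvPowerSeries.smul_eq_C_mul, map_smul, h1,
        smul_zero]
    | add p q hp hq => rw [MvPolynomial.coe_add, map_add, hp, hq, add_zero]
    | mul_X p i hp => rw [MvPolynomial.coe_mul, hT, hp, MvPolynomial.coe_X, hX]; simp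
  -- `T` loses at most one power of the ideal, hence is continuous; since it kills polynomials,
  -- truncating at `k + 1` puts `T f` in `I ^ k`.
  have hpow : ∀ (k : ℕ) (a : MvPowerSeries σ K), a ∈ varIdeal σ K ^ (k + 1) → T a ∈ I ^ k := by
    intro k
    induction k with
    | zero => simp
    | succ k ih =>
      intro a ha
      rw [pow_succ'] at ha
      refine Submodule.mul_induction_on ha (fun a ha b hb => ?_)
        (fun a b ha hb => by rw [map_add]; exact add_mem ha hb)
      rw [hT]
      refine add_mem (by rw [pow_succ']; exact Ideal.mul_mem_mul (hφ a ha) (ih b hb))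
        (Ideal.mul_mem_right _ _ ?_)
      have := Ideal.mem_map_of_mem φ' hb
      rw [Ideal.map_pow] at this
      refine Ideal.pow_right_mono ?_ _ this
      rw [Ideal.map_le_iff_le_comap]
      exact fun a ha => hφ' a ha
  refine hC _ fun k => ?_
  rw [← sub_add_cancel f (truncTotal (k + 1) f : MvPolynomial σ K), map_add, hpoly, add_zero]
  exact hpow k _ (sub_truncTotal_mem_varIdeal_pow f (k + 1))

/-- `twistedDerivation_eq_zero` for values modulo an ideal of a ring of formal power series. -/
theorem twistedDerivation_mem (N : Ideal (MvPowerSeries τ K))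
    (φ φ' : MvPowerSeries σ K →ₐ[K] MvPowerSeries τ K)
    (T : MvPowerSeries σ K →ₗ[K] MvPowerSeries τ K)
    (hT : ∀ a b, T (a * b) - (φ a * T b + φ' b * T a) ∈ N)
    (hX : ∀ i, T (X i) ∈ N) (f : MvPowerSeries σ K) : T f ∈ N := by
  rw [← Ideal.Quotient.eq_zero_iff_mem]
  refine twistedDerivation_eq_zero ((varIdeal τ K).map (Ideal.Quotient.mk N))
    (fun c hc => quotient_eq_zero_of_forall_mem_pow N hc) ((Ideal.Quotient.mkₐ K N).comp φ)
    ((Ideal.Quotient.mkₐ K N).comp φ')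
    (fun a ha => Ideal.mem_map_of_mem _ (algHom_mem_varIdeal φ ha))
    (fun a ha => Ideal.mem_map_of_mem _ (algHom_mem_varIdeal φ' ha))
    ((Ideal.Quotient.mkₐ K N).toLinearMap.comp T) (fun a b => ?_)
    (fun i => Ideal.Quotient.eq_zero_iff_mem.mpr (hX i)) f
  simpa using Ideal.Quotient.eq.mpr (hT a b)

/-- The difference `φ - φ'` satisfies the twisted Leibniz rule exactly. -/
theorem algHom_sub_mem (N : Ideal (MvPowerSeries τ K))
    (φ φ' : MvPowerSeries σ K →ₐ[K] MvPowerSeries τ K)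
    (hX : ∀ i, φ (X i) - φ' (X i) ∈ N) (f : MvPowerSeries σ K) : φ f - φ' f ∈ N :=
  twistedDerivation_mem N φ φ' (φ.toLinearMap - φ'.toLinearMap)
    (fun a b => by simp only [LinearMap.sub_apply, AlgHom.toLinearMap_apply, map_mul]
                   ring_nf; exact zero_mem _) hX f

theorem algHom_ext_X {φ φ' : MvPowerSeries σ K →ₐ[K] MvPowerSeries τ K}
    (hX : ∀ i, φ (X i) = φ' (X i)) : φ = φ' := by
  ext1 f
  have := algHom_sub_mem ⊥ φ φ' (fun i => by simp [hX i]) f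
  exact sub_eq_zero.mp this

end Uniqueness

/-! ### Chain rule and first-order Taylor formula -/

section Taylor

variable {σ τ K : Type*} [Field K] [Fintype σ] [Finite τ]

/-- The chain rule for a derivation along a homomorphism. -/
theorem derivation_along_eq_sum (φ : MvPowerSeries σ K →ₐ[K] MvPowerSeries τ K)
    (D : MvPowerSeries σ K →ₗ[K] MvPowerSeries τ K)
    (hD : ∀ a b, D (a * b) = φ a * D b + φ b * D a) (f : MvPowerSeries σ K) :
    D f = ∑ i, φ (pderiv K i f) * D (X i) := by
  classical
  let S : MvPowerSeries σ K →ₗ[K] MvPowerSeries τ K :=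
    ∑ i, (LinearMap.mulRight K (D (X i))).comp (φ.toLinearMap.comp (pderiv K i).toLinearMap)
  have hS : ∀ f, S f = ∑ i, φ (pderiv K i f) * D (X i) := by
    intro f; simp [S]
  have := twistedDerivation_mem ⊥ φ φ (D - S) (fun a b => ?_) (fun i => ?_) f
  · rw [← hS]
    exact sub_eq_zero.mp this
  · simp only [LinearMap.sub_apply, hD, hS, Derivation.leibniz, smul_eq_mul, map_add, map_mul,
      add_mul, Finset.sum_add_distrib, mul_sub, Finset.mul_sum, ← mul_assoc, Ideal.mem_bot]
    ring
  · simp only [LinearMap.sub_apply, hS, Ideal.mem_bot]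
    rw [Finset.sum_eq_single i]
    · simp [pderiv_X_self]
    · intro j _ hj
      rw [pderiv_X_of_ne hj.symm]
      simp
    · simp

/-- First order Taylor expansion. -/
theorem algHom_taylor_mem (φ φ' : MvPowerSeries σ K →ₐ[K] MvPowerSeries τ K)
    (Δ : Ideal (MvPowerSeries τ K)) (hΔ : ∀ i, φ' (X i) - φ (X i) ∈ Δ) (f : MvPowerSeries σ K) :
    φ' f - φ f - ∑ i, φ (pderiv K i f) * (φ' (X i) - φ (X i)) ∈ Δ ^ 2 := by
  classical
  let S : MvPowerSeries σ K →ₗ[K] MvPowerSeries τ K :=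
    ∑ i, (LinearMap.mulRight K (φ' (X i) - φ (X i))).comp
      (φ.toLinearMap.comp (pderiv K i).toLinearMap)
  have hS : ∀ f, S f = ∑ i, φ (pderiv K i f) * (φ' (X i) - φ (X i)) := by
    intro f; simp [S]
  have hSΔ : ∀ f, S f ∈ Δ := fun f => by
    rw [hS]
    exact sum_mem fun i _ => Ideal.mul_mem_left _ _ (hΔ i)
  have hSmul : ∀ a b, S (a * b) = φ a * S b + φ b * S a := by
    intro a b
    simp only [hS, Derivation.leibniz, smul_eq_mul, map_add, map_mul,
      add_mul, Finset.sum_add_distrib, Finset.mul_sum, ← mul_assoc]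
  have := twistedDerivation_mem (Δ ^ 2) φ φ' (φ'.toLinearMap - φ.toLinearMap - S)
    (fun a b => ?_) (fun i => ?_) f
  · rw [← hS]
    exact this
  -- The Taylor remainder fails the twisted Leibniz rule by exactly `(φ' b - φ b) * S a`, a product
  -- of two elements of `Δ`.
  · have h : (φ' b - φ b) * S a ∈ Δ ^ 2 := by
      rw [pow_two]
      exact Ideal.mul_mem_mul (algHom_sub_mem Δ φ' φ hΔ b) (hSΔ a)
    convert h using 1
    simp only [LinearMap.sub_apply, AlgHom.toLinearMap_apply, map_mul, hSmul]
    ring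
  · have : S (X i) = φ' (X i) - φ (X i) := by
      rw [hS, Finset.sum_eq_single i]
      · simp [pderiv_X_self]
      · intro j _ hj
        rw [pderiv_X_of_ne hj.symm]
        simp
      · simp
    simp [this]

end Taylor

variable {K : Type*} [Field K]

/-! ### Rings over the parameters: inclusions and restriction to zero -/

section Families

variable {n m l : ℕ}

/-- The inclusion `K[[x]] → K[[x, λ]]`. -/
noncomputable def spaceIncl (K : Type*) [Field K] (n m : ℕ) :
    MvPowerSeries (Fin n) K →ₐ[K] MvPowerSeries (Fin n ⊕ Fin m) K :=
  rename (Function.Embedding.inl : Fin n ↪ Fin n ⊕ Fin m)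

/-- The ideal of `K[[x, λ]]` generated by the parameters `λ`. -/
noncomputable abbrev paramIdeal (K : Type*) [Field K] (n m : ℕ) :
    Ideal (MvPowerSeries (Fin n ⊕ Fin m) K) :=
  (varIdeal (Fin m) K).map (paramIncl K n m)

@[simp]
theorem spaceIncl_X (i : Fin n) : spaceIncl K n m (X i) = X (Sum.inl i) := rename_X _ i

@[simp]
theorem paramIncl_X (j : Fin m) : paramIncl K n m (X j) = X (Sum.inr j) := rename_X _ j

@[simp]
theorem restrictZero_X_inl (i : Fin n) : restrictZero K n m (X (Sum.inl i)) = X i :=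
  killCompl_X (e := (Function.Embedding.inl : Fin n ↪ Fin n ⊕ Fin m)) i

@[simp]
theorem restrictZero_X_inr (j : Fin m) : restrictZero K n m (X (Sum.inr j)) = 0 :=
  killCompl_X_eq_zero (by simp)

@[simp]
theorem restrictZero_spaceIncl (f : MvPowerSeries (Fin n) K) :
    restrictZero K n m (spaceIncl K n m f) = f :=
  killCompl_rename_app f

theorem paramIncl_mem_paramIdeal {z : MvPowerSeries (Fin m) K} (hz : z ∈ varIdeal (Fin m) K) :
    paramIncl K n m z ∈ paramIdeal K n m :=
  Ideal.mem_map_of_mem _ hz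

theorem paramIncl_mem_paramIdeal_pow {z : MvPowerSeries (Fin m) K} {k : ℕ}
    (hz : z ∈ varIdeal (Fin m) K ^ k) : paramIncl K n m z ∈ paramIdeal K n m ^ k := by
  rw [← Ideal.map_pow]
  exact Ideal.mem_map_of_mem _ hz

theorem X_inr_mem_paramIdeal (j : Fin m) :
    (X (Sum.inr j) : MvPowerSeries (Fin n ⊕ Fin m) K) ∈ paramIdeal K n m := by
  rw [← paramIncl_X]
  exact paramIncl_mem_paramIdeal (Ideal.subset_span ⟨j, rfl⟩)

theorem paramIdeal_le_varIdeal : paramIdeal K n m ≤ varIdeal (Fin n ⊕ Fin m) K := by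
  rw [Ideal.map_le_iff_le_comap]
  exact fun a ha => algHom_mem_varIdeal _ ha

theorem sub_spaceIncl_restrictZero_mem (H : MvPowerSeries (Fin n ⊕ Fin m) K) :
    H - spaceIncl K n m (restrictZero K n m H) ∈ paramIdeal K n m := by
  refine algHom_sub_mem (paramIdeal K n m) (AlgHom.id K _)
    ((spaceIncl K n m).comp (restrictZero K n m)) ?_ H
  rintro (i | j)
  · simp
  · simpa using X_inr_mem_paramIdeal j

theorem restrictZero_pderiv_inl (F : MvPowerSeries (Fin n ⊕ Fin m) K) (i : Fin n) :
    restrictZero K n m (pderiv K (Sum.inl i) F) = pderiv K i (restrictZero K n m F) := by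
  ext d
  simp only [restrictZero, coeff_killCompl, coeff_pderiv, Finsupp.embDomain_add,
    Finsupp.embDomain_single]
  have : (Finsupp.embDomain (Function.Embedding.inl : Fin n ↪ Fin n ⊕ Fin m) d) (Sum.inl i) = d i :=
    Finsupp.embDomain_apply_self Function.Embedding.inl d i
  rw [this]
  rfl

/-- Existence of homomorphisms over the parameters with prescribed images of the variables. -/
theorem exists_algHom_pair (y : Fin n → MvPowerSeries (Fin n ⊕ Fin l) K)
    (hy : ∀ i, y i ∈ varIdeal (Fin n ⊕ Fin l) K)
    (z : Fin m → MvPowerSeries (Fin l) K) (hz : ∀ j, z j ∈ varIdeal (Fin l) K) :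
    ∃ (φ : MvPowerSeries (Fin n ⊕ Fin m) K →ₐ[K] MvPowerSeries (Fin n ⊕ Fin l) K)
      (ψ : MvPowerSeries (Fin m) K →ₐ[K] MvPowerSeries (Fin l) K),
      φ.comp (paramIncl K n m) = (paramIncl K n l).comp ψ ∧
      (∀ i, φ (X (Sum.inl i)) = y i) ∧ ∀ j, ψ (X j) = z j := by
  have h1 : HasSubst (Sum.elim y fun j => paramIncl K n l (z j)) := by
    refine hasSubst_of_constantCoeff_zero ?_
    rintro (i | j)
    · exact mem_varIdeal_iff.mp (hy i)
    · exact mem_varIdeal_iff.mp (algHom_mem_varIdeal _ (hz j))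
  have h2 : HasSubst z := hasSubst_of_constantCoeff_zero fun j => mem_varIdeal_iff.mp (hz j)
  refine ⟨substAlgHom h1, substAlgHom h2, algHom_ext_X fun j => ?_, fun i => ?_, fun j => ?_⟩
  · simp [subst_X h1, subst_X h2]
  · simp [subst_X h1]
  · simp [subst_X h2]

end Families

/-! ### Sufficiency: order-by-order construction of the inducing homomorphism -/

section Lifting

variable {n m l : ℕ} {f : MvPowerSeries (Fin n) K} {F : MvPowerSeries (Fin n ⊕ Fin m) K}

theorem exists_eq_add_of_span_initialVelocity_eq_top
    (hspan : Submodule.span K (Set.range fun i : Fin m =>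
        (Ideal.Quotient.mk (jacobianIdeal f) (initialVelocity F i))) = ⊤)
    (g : MvPowerSeries (Fin n) K) :
    ∃ (h : Fin n → MvPowerSeries (Fin n) K) (c : Fin m → K),
      g = ∑ i, pderiv K i f * h i + ∑ j, c j • initialVelocity F j := by
  have hg : Ideal.Quotient.mk (jacobianIdeal f) g ∈ Submodule.span K (Set.range fun i : Fin m =>
        (Ideal.Quotient.mk (jacobianIdeal f) (initialVelocity F i))) := hspan ▸ Submodule.mem_top
  obtain ⟨c, hc⟩ := (Submodule.mem_span_range_iff_exists_fun K).mp hg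
  have hmem : g - ∑ j, c j • initialVelocity F j ∈ jacobianIdeal f := by
    rw [← Ideal.Quotient.eq, ← hc, map_sum]
    rfl
  obtain ⟨h, hh⟩ := (Ideal.mem_span_range_iff_exists_fun).mp hmem
  refine ⟨h, c, ?_⟩
  rw [← sub_eq_iff_eq_add, ← hh]
  simp only [mul_comm]

/-- Solution of the linearised equation in degree `k` with respect to the parameters. -/
theorem exists_sub_mem_paramIdeal_pow_succ
    (hspan : Submodule.span K (Set.range fun i : Fin m =>
        (Ideal.Quotient.mk (jacobianIdeal f) (initialVelocity F i))) = ⊤)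
    (k : ℕ) (e : MvPowerSeries (Fin n ⊕ Fin l) K) (he : e ∈ paramIdeal K n l ^ k) :
    ∃ (ξ : Fin n → MvPowerSeries (Fin n ⊕ Fin l) K) (η : Fin m → MvPowerSeries (Fin l) K),
      (∀ i, ξ i ∈ paramIdeal K n l ^ k) ∧ (∀ j, η j ∈ varIdeal (Fin l) K ^ k) ∧
      e - (∑ i, spaceIncl K n l (pderiv K i f) * ξ i +
        ∑ j, spaceIncl K n l (initialVelocity F j) * paramIncl K n l (η j)) ∈
          paramIdeal K n l ^ (k + 1) := by
  rw [← Ideal.map_pow] at he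
  induction he using Submodule.closure_induction with
  | zero => exact ⟨0, 0, by simp, by simp, by simp⟩
  | add a b _ _ ha hb =>
    obtain ⟨ξ, η, h1, h2, h3⟩ := ha
    obtain ⟨ξ', η', h1', h2', h3'⟩ := hb
    refine ⟨ξ + ξ', η + η', fun i => add_mem (h1 i) (h1' i), fun j => add_mem (h2 j) (h2' j), ?_⟩
    convert add_mem h3 h3' using 1
    simp only [Pi.add_apply, map_add, mul_add, Finset.sum_add_distrib]
    ring
  | smul_mem b x hx =>
    obtain ⟨s, hs, rfl⟩ := hx
    obtain ⟨h, c, hb⟩ := exists_eq_add_of_span_initialVelocity_eq_top hspan (restrictZero K n l b)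
    have hs' := paramIncl_mem_paramIdeal_pow (n := n) hs
    -- Only `b(x, 0)` matters at order `k`. The velocities enter it with coefficients `c j` in `K`,
    -- so `η j = c j • s` is free of `x`, as the image of a parameter must be.
    refine ⟨fun i => spaceIncl K n l (h i) * paramIncl K n l s, fun j => c j • s,
      fun i => Ideal.mul_mem_left _ _ hs', fun j => Submodule.smul_of_tower_mem _ (c j) hs, ?_⟩
    have := Ideal.mul_mem_mul (sub_spaceIncl_restrictZero_mem b) hs'
    rw [← pow_succ'] at this
    convert this using 1
    rw [hb]
    simp only [map_add, map_sum, map_mul, map_smul, smul_eq_mul, sub_mul, add_mul, Finset.sum_mul,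
      mul_assoc, smul_mul_assoc, mul_smul_comm]

/-- A homomorphism over the parameters which is the identity modulo the parameters. -/
structure LiftPair (n m l : ℕ) (K : Type*) [Field K] where
  /-- The homomorphism of the total rings. -/
  total : MvPowerSeries (Fin n ⊕ Fin m) K →ₐ[K] MvPowerSeries (Fin n ⊕ Fin l) K
  /-- The homomorphism of the parameter rings. -/
  base : MvPowerSeries (Fin m) K →ₐ[K] MvPowerSeries (Fin l) K
  comp_eq : total.comp (paramIncl K n m) = (paramIncl K n l).comp base
  total_X_sub : ∀ i, total (X (Sum.inl i)) - X (Sum.inl i) ∈ paramIdeal K n l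

theorem LiftPair.total_X_inr (p : LiftPair n m l K) (j : Fin m) :
    p.total (X (Sum.inr j)) = paramIncl K n l (p.base (X j)) := by
  have := DFunLike.congr_fun p.comp_eq (X j)
  simpa using this

/-- Modulo the parameters every pair is evaluation at `λ = 0`. In the Taylor formula this replaces
the derivatives of `F` by those of `f` and by the initial velocities. -/
theorem LiftPair.total_sub_mem (p : LiftPair n m l K) (H : MvPowerSeries (Fin n ⊕ Fin m) K) :
    p.total H - spaceIncl K n l (restrictZero K n m H) ∈ paramIdeal K n l := by
  refine algHom_sub_mem (paramIdeal K n l) p.total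
    ((spaceIncl K n l).comp (restrictZero K n m)) ?_ H
  rintro (i | j)
  · simpa using p.total_X_sub i
  · simpa [p.total_X_inr] using
      paramIncl_mem_paramIdeal (n := n) (algHom_mem_varIdeal p.base (Ideal.subset_span ⟨j, rfl⟩))

theorem exists_liftPair (y : Fin n → MvPowerSeries (Fin n ⊕ Fin l) K)
    (hy : ∀ i, y i - X (Sum.inl i) ∈ paramIdeal K n l)
    (z : Fin m → MvPowerSeries (Fin l) K) (hz : ∀ j, z j ∈ varIdeal (Fin l) K) :
    ∃ p : LiftPair n m l K, (∀ i, p.total (X (Sum.inl i)) = y i) ∧ ∀ j, p.base (X j) = z j := by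
  obtain ⟨φ, ψ, h, hφ, hψ⟩ := exists_algHom_pair y (fun i => by
    rw [← sub_add_cancel (y i) (X (Sum.inl i))]
    exact add_mem (paramIdeal_le_varIdeal (hy i)) (Ideal.subset_span ⟨_, rfl⟩)) z hz
  exact ⟨⟨φ, ψ, h, fun i => by rw [hφ]; exact hy i⟩, hφ, hψ⟩

/-- Two pairs agree on the variables up to order `k` in the parameters. -/
def LiftPair.Agree (k : ℕ) (p q : LiftPair n m l K) : Prop :=
  (∀ i, q.total (X (Sum.inl i)) - p.total (X (Sum.inl i)) ∈ paramIdeal K n l ^ k) ∧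
    ∀ j, q.base (X j) - p.base (X j) ∈ varIdeal (Fin l) K ^ k

/-- The solution `ξ`, `η` of the linearised equation for the error `G - p.total F` is added to the
images of the variables; the rest of the Taylor expansion has higher order. -/
theorem LiftPair.exists_improve
    (hspan : Submodule.span K (Set.range fun i : Fin m =>
        (Ideal.Quotient.mk (jacobianIdeal f) (initialVelocity F i))) = ⊤)
    (hF : IsDeformation F f) (G : MvPowerSeries (Fin n ⊕ Fin l) K) (k : ℕ)
    (p : LiftPair n m l K) (hp : p.total F - G ∈ paramIdeal K n l ^ (k + 1)) :
    ∃ q : LiftPair n m l K, q.total F - G ∈ paramIdeal K n l ^ (k + 2) ∧ p.Agree (k + 1) q := by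
  obtain ⟨ξ, η, hξ, hη, h⟩ := exists_sub_mem_paramIdeal_pow_succ (F := F) hspan (k + 1)
    (G - p.total F) (by rw [← neg_mem_iff, neg_sub]; exact hp)
  have hbase : ∀ j, p.base (X j) ∈ varIdeal (Fin l) K := fun j =>
    algHom_mem_varIdeal p.base (Ideal.subset_span ⟨j, rfl⟩)
  obtain ⟨q, hq1, hq2⟩ := exists_liftPair (fun i => p.total (X (Sum.inl i)) + ξ i)
    (fun i => by
      rw [add_sub_right_comm]
      exact add_mem (p.total_X_sub i) (Ideal.pow_le_self (Nat.succ_ne_zero k) (hξ i)))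
    (fun j => p.base (X j) + η j)
    (fun j => add_mem (hbase j) (Ideal.pow_le_self (Nat.succ_ne_zero k) (hη j)))
  have hd1 : ∀ i, q.total (X (Sum.inl i)) - p.total (X (Sum.inl i)) = ξ i := fun i => by
    rw [hq1, add_sub_cancel_left]
  have hd2 : ∀ j, q.total (X (Sum.inr j)) - p.total (X (Sum.inr j)) =
      paramIncl K n l (η j) := fun j => by
    rw [q.total_X_inr, p.total_X_inr, hq2, map_add, add_sub_cancel_left]
  refine ⟨q, ?_, fun i => ?_, fun j => ?_⟩
  · have ht := algHom_taylor_mem p.total q.total (paramIdeal K n l ^ (k + 1)) (by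
      rintro (i | j)
      · rw [hd1]; exact hξ i
      · rw [hd2]; exact paramIncl_mem_paramIdeal_pow (hη j)) F
    rw [← pow_mul, Fintype.sum_sum_type] at ht
    -- The quadratic remainder has order `2(k+1) ≥ k+2`; this is why the induction starts at order
    -- 1.
    replace ht := Ideal.pow_le_pow_right (by omega : k + 2 ≤ (k + 1) * 2) ht
    have h1 : ∑ i, (p.total (pderiv K (Sum.inl i) F) - spaceIncl K n l (pderiv K i f)) * ξ i ∈
        paramIdeal K n l ^ (k + 2) := sum_mem fun i _ => by
      rw [pow_succ' _ (k + 1), ← hF, ← restrictZero_pderiv_inl]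
      exact Ideal.mul_mem_mul (p.total_sub_mem _) (hξ i)
    have h2 : ∑ j, (p.total (pderiv K (Sum.inr j) F) - spaceIncl K n l (initialVelocity F j)) *
        paramIncl K n l (η j) ∈ paramIdeal K n l ^ (k + 2) := sum_mem fun j _ => by
      rw [pow_succ' _ (k + 1)]
      exact Ideal.mul_mem_mul (p.total_sub_mem _) (paramIncl_mem_paramIdeal_pow (hη j))
    convert sub_mem (add_mem (add_mem ht h1) h2) h using 1
    simp only [hd1, hd2, sub_mul, Finset.sum_sub_distrib]
    ring
  · rw [hd1]; exact hξ i
  · rw [hq2, add_sub_cancel_left]; exact hη j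

theorem exists_limit {σ : Type*} [Finite σ] (y : ℕ → MvPowerSeries σ K)
    (hy : ∀ k, y (k + 1) - y k ∈ varIdeal σ K ^ (k + 1)) :
    ∃ L, ∀ k, y k - L ∈ varIdeal σ K ^ (k + 1) := by
  have hcauchy : ∀ {a b : ℕ}, a ≤ b → y b - y a ∈ varIdeal σ K ^ (a + 1) := by
    intro a b hab
    induction b, hab using Nat.le_induction with
    | base => simp
    | succ b hab ih =>
      rw [← sub_add_sub_cancel _ (y b)]
      exact add_mem (Ideal.pow_le_pow_right (by omega) (hy b)) ih
  obtain ⟨L, hL⟩ := IsPrecomplete.prec (I := varIdeal σ K) (M := MvPowerSeries σ K) inferInstance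
    (f := y) (fun {a b} hab => by
      rw [SModEq.comm, SModEq.sub_mem, smul_eq_mul, Ideal.mul_top]
      exact Ideal.pow_le_pow_right (Nat.le_succ a) (hcauchy hab))
  refine ⟨L, fun k => ?_⟩
  have := hL (k + 1)
  rw [SModEq.sub_mem, smul_eq_mul, Ideal.mul_top] at this
  rw [← sub_add_sub_cancel _ (y (k + 1)), ← neg_sub (y (k + 1))]
  exact add_mem (neg_mem (hy k)) this

theorem isInducedFrom_of_span_eq_top
    (hspan : Submodule.span K (Set.range fun i : Fin m =>
        (Ideal.Quotient.mk (jacobianIdeal f) (initialVelocity F i))) = ⊤)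
    (hF : IsDeformation F f) (G : MvPowerSeries (Fin n ⊕ Fin l) K) (hG : IsDeformation G f) :
    IsInducedFrom G F := by
  obtain ⟨p₀, -, -⟩ := exists_liftPair (K := K) (n := n) (m := m) (l := l)
    (fun i => X (Sum.inl i)) (by simp) (fun _ => 0) (by simp)
  -- Both series reduce to `f` modulo the parameters.
  have hp₀ : p₀.total F - G ∈ paramIdeal K n l ^ (0 + 1) := by
    have h1 := p₀.total_sub_mem F
    have h2 := sub_spaceIncl_restrictZero_mem G
    rw [show restrictZero K n m F = f from hF] at h1
    rw [show restrictZero K n l G = f from hG] at h2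
    simpa using sub_mem h1 h2
  choose! next hnext hagree using fun k p => LiftPair.exists_improve hspan hF G k p
  let P : ℕ → LiftPair n m l K := fun k => Nat.rec p₀ (fun k p => next k p) k
  have hP : ∀ k, (P k).total F - G ∈ paramIdeal K n l ^ (k + 1) := fun k => by
    induction k with
    | zero => exact hp₀
    | succ k ih => exact hnext k (P k) ih
  have hPa : ∀ k, (P k).Agree (k + 1) (P (k + 1)) := fun k => hagree k (P k) (hP k)
  -- Limits are taken in the topology of all variables, in which the rings are complete; powers of
  -- the parameter ideal lie in powers of the maximal ideal.
  choose y hy using fun i : Fin n => exists_limit (fun k => (P k).total (X (Sum.inl i)))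
    (fun k => Ideal.pow_right_mono paramIdeal_le_varIdeal _ ((hPa k).1 i))
  choose z hz using fun j : Fin m => exists_limit (fun k => (P k).base (X j))
    (fun k => (hPa k).2 j)
  obtain ⟨φ, ψ, hcomp, hφ, hψ⟩ := exists_algHom_pair y (fun i => by
      rw [← sub_sub_cancel ((P 0).total (X (Sum.inl i))) (y i)]
      exact sub_mem (algHom_mem_varIdeal _ (Ideal.subset_span ⟨_, rfl⟩)) (by simpa using hy i 0))
    z (fun j => by
      rw [← sub_sub_cancel ((P 0).base (X j)) (z j)]
      exact sub_mem (algHom_mem_varIdeal _ (Ideal.subset_span ⟨_, rfl⟩)) (by simpa using hz j 0))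
  refine ⟨φ, ψ, hcomp, ?_⟩
  rw [← sub_eq_zero, ← Ideal.mem_bot]
  refine mem_of_forall_mem_sup_pow ⊥ fun k => ?_
  rw [bot_sup_eq]
  refine Ideal.pow_le_pow_right (Nat.le_succ k) ?_
  rw [← sub_add_sub_cancel _ ((P k).total F)]
  refine add_mem ?_ (Ideal.pow_right_mono paramIdeal_le_varIdeal _ (hP k))
  rw [← neg_mem_iff, neg_sub]
  refine algHom_sub_mem _ (P k).total φ ?_ F
  rintro (i | j)
  · rw [hφ]; exact hy i k
  · have := DFunLike.congr_fun hcomp (X j)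
    simp only [AlgHom.comp_apply, paramIncl_X, hψ] at this
    rw [this, LiftPair.total_X_inr, ← map_sub]
    exact algHom_mem_varIdeal_pow _ (hz j k)

end Lifting

/-! ### Necessity: initial velocities of an induced deformation -/

section Tangent

variable {n m l : ℕ} {f : MvPowerSeries (Fin n) K} {F : MvPowerSeries (Fin n ⊕ Fin m) K}

theorem sub_algebraMap_constantCoeff_mem {σ : Type*} [Finite σ] (z : MvPowerSeries σ K) :
    z - algebraMap K _ (constantCoeff z) ∈ varIdeal σ K := by
  rw [mem_varIdeal_iff, MvPowerSeries.algebraMap_apply]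
  simp

theorem restrictZero_paramIncl (z : MvPowerSeries (Fin m) K) :
    restrictZero K n m (paramIncl K n m z) = algebraMap K _ (constantCoeff z) := by
  have h : varIdeal (Fin m) K ≤
      RingHom.ker ((restrictZero K n m).comp (paramIncl K n m)) := by
    rw [Ideal.span_le]
    rintro _ ⟨j, rfl⟩
    simp [RingHom.mem_ker]
  have := h (sub_algebraMap_constantCoeff_mem z)
  rw [RingHom.mem_ker, map_sub, AlgHom.commutes, sub_eq_zero] at this
  exact this

theorem pderiv_inr_spaceIncl (a : Fin l) (g : MvPowerSeries (Fin n) K) :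
    pderiv K (Sum.inr a) (spaceIncl K n l g) = 0 := by
  refine twistedDerivation_mem ⊥ (spaceIncl K n l) (spaceIncl K n l)
    ((pderiv K (Sum.inr a)).toLinearMap.comp (spaceIncl K n l).toLinearMap) (fun b c => ?_)
    (fun i => ?_) g
  · simp
  · simp [pderiv_X_of_ne]

theorem pderiv_inr_paramIncl (a : Fin l) (z : MvPowerSeries (Fin l) K) :
    pderiv K (Sum.inr a) (paramIncl K n l z) = paramIncl K n l (pderiv K a z) := by
  refine sub_eq_zero.mp (twistedDerivation_mem ⊥ (paramIncl K n l) (paramIncl K n l)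
    ((pderiv K (Sum.inr a)).toLinearMap.comp (paramIncl K n l).toLinearMap -
      (paramIncl K n l).toLinearMap.comp (pderiv K a).toLinearMap) (fun b c => ?_)
    (fun i => ?_) z)
  · simp
    ring
  · classical
    simp [pderiv_X, Pi.single_apply]

/-- The deformation `f + ∑ αₐ gₐ`. -/
noncomputable def linearDeformation (f : MvPowerSeries (Fin n) K)
    (g : Fin l → MvPowerSeries (Fin n) K) : MvPowerSeries (Fin n ⊕ Fin l) K :=
  spaceIncl K n l f + ∑ a, X (Sum.inr a) * spaceIncl K n l (g a)

theorem isDeformation_linearDeformation (g : Fin l → MvPowerSeries (Fin n) K) :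
    IsDeformation (linearDeformation f g) f := by
  simp [IsDeformation, linearDeformation]

theorem initialVelocity_linearDeformation (g : Fin l → MvPowerSeries (Fin n) K) (a : Fin l) :
    initialVelocity (linearDeformation f g) a = g a := by
  classical
  simp [initialVelocity, linearDeformation, pderiv_inr_spaceIncl, pderiv_X, Pi.single_apply,
    apply_ite]

/-- The span of the initial velocities. -/
noncomputable abbrev velocitySpan (F : MvPowerSeries (Fin n ⊕ Fin m) K) :
    Submodule K (MvPowerSeries (Fin n) K) :=
  Submodule.span K (Set.range (initialVelocity F))

/-- The initial velocities of an induced deformation. -/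
theorem exists_initialVelocity_mem_of_isInducedFrom (hF : IsDeformation F f)
    {G : MvPowerSeries (Fin n ⊕ Fin l) K} (hG : IsInducedFrom G F) :
    ∃ φ₀ : MvPowerSeries (Fin n) K →ₐ[K] MvPowerSeries (Fin n) K, ∀ a,
      initialVelocity G a ∈ (velocitySpan F).map φ₀.toLinearMap ⊔
        ((jacobianIdeal f).map φ₀).restrictScalars K := by
  obtain ⟨φ, ψ, hcomp, rfl⟩ := hG
  have hinr : ∀ j, φ (X (Sum.inr j)) = paramIncl K n l (ψ (X j)) := fun j => by
    simpa using DFunLike.congr_fun hcomp (X j)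
  set φ₀ := ((restrictZero K n l).comp φ).comp (spaceIncl K n m) with hφ₀
  -- Since `ψ` is local, `φ (λⱼ)` vanishes at `α = 0`, so `φ` at `α = 0` depends only on the
  -- restriction to `λ = 0`.
  have hfac : (restrictZero K n l).comp φ = φ₀.comp (restrictZero K n m) := by
    refine algHom_ext_X ?_
    rintro (i | j)
    · simp [hφ₀]
    · have : constantCoeff (ψ (X j)) = 0 :=
        mem_varIdeal_iff.mp (algHom_mem_varIdeal ψ (Ideal.subset_span ⟨j, rfl⟩))
      simp [hinr, restrictZero_paramIncl, this]
  refine ⟨φ₀, fun a => ?_⟩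
  have hD := derivation_along_eq_sum ((restrictZero K n l).comp φ)
    ((restrictZero K n l).toLinearMap.comp
      ((pderiv K (Sum.inr a)).toLinearMap.comp φ.toLinearMap)) (fun b c => by simp) F
  rw [hfac, Fintype.sum_sum_type] at hD
  change initialVelocity (φ F) a = _ at hD
  rw [hD, add_comm]
  refine Submodule.add_mem_sup (sum_mem fun j _ => ?_) (sum_mem fun i _ => ?_)
  -- As `φ (λⱼ)` is a series in `α` alone, its derivative at `α = 0` is a scalar: this term stays in
  -- the image of `V`. The `x`-terms below have arbitrary coefficients in `K[[x]]`, whence the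
  -- ideal.
  · refine ⟨constantCoeff (pderiv K a (ψ (X j))) • initialVelocity F j,
      Submodule.smul_mem _ _ (Submodule.subset_span ⟨j, rfl⟩), ?_⟩
    simp only [AlgHom.toLinearMap_apply, LinearMap.comp_apply, hinr,
      Derivation.coeFn_coe, pderiv_inr_paramIncl, restrictZero_paramIncl, Algebra.smul_def,
      AlgHom.comp_apply, initialVelocity]
    rw [mul_comm, map_mul, AlgHom.commutes]
  · refine Ideal.mul_mem_right _ _ (Ideal.mem_map_of_mem φ₀ ?_)
    have : restrictZero K n m (pderiv K (Sum.inl i) F) = pderiv K i f := by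
      rw [restrictZero_pderiv_inl, show restrictZero K n m F = f from hF]
    exact this ▸ Ideal.subset_span ⟨i, rfl⟩

end Tangent

/-! ### Endomorphisms onto the cotangent space, and descent from all jets -/

section Endomorphism

variable {σ : Type*} [Finite σ]

theorem mem_sup_varIdeal_pow_of_monomial_mem (W : Submodule K (MvPowerSeries σ K)) (k : ℕ)
    (hW : ∀ d : σ →₀ ℕ, d.degree < k → monomial d (1 : K) ∈ W) (g : MvPowerSeries σ K) :
    ∃ w ∈ W, g - w ∈ varIdeal σ K ^ k := by
  refine ⟨_, ?_, sub_truncTotal_mem_varIdeal_pow g k⟩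
  rw [(truncTotal k g).as_sum, ← MvPolynomial.coeToMvPowerSeries.ringHom_apply, map_sum]
  refine sum_mem fun d hd => ?_
  have hdk : d.degree < k := by
    by_contra h
    rw [MvPolynomial.mem_support_iff, coeff_truncTotal_eq_zero _ (not_lt.mp h)] at hd
    exact hd rfl
  rw [MvPolynomial.coeToMvPowerSeries.ringHom_apply, MvPolynomial.coe_monomial,
    ← mul_one (MvPolynomial.coeff _ _), ← smul_eq_mul, map_smul]
  exact W.smul_mem _ (hW d hdk)

theorem finite_quotient_varIdeal_pow (k : ℕ) :
    Module.Finite K (MvPowerSeries σ K ⧸ (varIdeal σ K ^ k).restrictScalars K) := by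
  have : Finite {d : σ →₀ ℕ // d.degree < k} := (Finsupp.finite_of_degree_lt k).to_subtype
  let s := Set.range fun d : {d : σ →₀ ℕ // d.degree < k} =>
    Submodule.Quotient.mk (p := (varIdeal σ K ^ k).restrictScalars K) (monomial d.1 (1 : K))
  have hs : s.Finite := Set.finite_range _
  refine ⟨⟨hs.toFinset, ?_⟩⟩
  rw [Set.Finite.coe_toFinset, eq_top_iff]
  rintro x -
  obtain ⟨g, rfl⟩ := Submodule.Quotient.mk_surjective _ x
  obtain ⟨w, hw, hgw⟩ := mem_sup_varIdeal_pow_of_monomial_mem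
    ((Submodule.span K s).comap (Submodule.mkQ ((varIdeal σ K ^ k).restrictScalars K))) k
    (fun d hd => Submodule.subset_span ⟨⟨d, hd⟩, rfl⟩) g
  have : Submodule.Quotient.mk (p := (varIdeal σ K ^ k).restrictScalars K) g =
      Submodule.Quotient.mk w := (Submodule.Quotient.eq _).mpr hgw
  rw [this]
  exact hw

variable {φ : MvPowerSeries σ K →ₐ[K] MvPowerSeries σ K}

/-- The hypothesis `hX` states surjectivity on `𝔪/𝔪²` for the variables, which span it over `K`;
only the constant term of a coefficient counts modulo `𝔪²`. -/
theorem exists_sub_algHom_mem_sq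
    (hX : ∀ i, ∃ a ∈ varIdeal σ K, X i - φ a ∈ varIdeal σ K ^ 2)
    (b : MvPowerSeries σ K) (hb : b ∈ varIdeal σ K) :
    ∃ a ∈ varIdeal σ K, b - φ a ∈ varIdeal σ K ^ 2 := by
  induction hb using Submodule.closure_induction with
  | zero => exact ⟨0, zero_mem _, by simp⟩
  | add x y _ _ hx hy =>
    obtain ⟨a, ha, h⟩ := hx
    obtain ⟨a', ha', h'⟩ := hy
    exact ⟨a + a', add_mem ha ha', by rw [map_add, add_sub_add_comm]; exact add_mem h h'⟩
  | smul_mem r x hx =>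
    obtain ⟨i, rfl⟩ := hx
    obtain ⟨a, ha, h⟩ := hX i
    refine ⟨constantCoeff r • a, Submodule.smul_of_tower_mem _ _ ha, ?_⟩
    have h1 : (r - algebraMap K _ (constantCoeff r)) * X i ∈ varIdeal σ K ^ 2 := by
      rw [pow_two]
      exact Ideal.mul_mem_mul (sub_algebraMap_constantCoeff_mem r) (Ideal.subset_span ⟨i, rfl⟩)
    convert add_mem h1 (Submodule.smul_of_tower_mem _ (constantCoeff r) h) using 1
    simp only [map_mul, AlgHom.commutes, smul_eq_mul, Algebra.smul_def]
    ring

/-- Products of elements of `𝔪` generate `𝔪^k/𝔪^(k+1)`, and `φ` is multiplicative. -/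
theorem exists_sub_algHom_mem_pow_succ
    (hX : ∀ i, ∃ a ∈ varIdeal σ K, X i - φ a ∈ varIdeal σ K ^ 2) (k : ℕ)
    (b : MvPowerSeries σ K) (hb : b ∈ varIdeal σ K ^ k) :
    ∃ a ∈ varIdeal σ K ^ k, b - φ a ∈ varIdeal σ K ^ (k + 1) := by
  induction k generalizing b with
  | zero =>
    refine ⟨algebraMap K _ (constantCoeff b), by simp, ?_⟩
    rw [AlgHom.commutes]
    simpa using sub_algebraMap_constantCoeff_mem b
  | succ k ih =>
    rw [pow_succ] at hb
    refine Submodule.mul_induction_on hb (fun x hx y hy => ?_) (fun x y hx hy => ?_)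
    · obtain ⟨a, ha, h⟩ := ih x hx
      obtain ⟨a', ha', h'⟩ := exists_sub_algHom_mem_sq hX y hy
      refine ⟨a * a', by rw [pow_succ]; exact Ideal.mul_mem_mul ha ha', ?_⟩
      have h1 := Ideal.mul_mem_mul h hy
      have h2 := Ideal.mul_mem_mul (algHom_mem_varIdeal_pow φ ha) h'
      rw [← pow_succ] at h1
      rw [← pow_add] at h2
      convert add_mem h1 h2 using 1
      rw [map_mul]
      ring
    · obtain ⟨a, ha, h⟩ := hx
      obtain ⟨a', ha', h'⟩ := hy
      exact ⟨a + a', add_mem ha ha', by rw [map_add, add_sub_add_comm]; exact add_mem h h'⟩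

theorem exists_sub_algHom_mem_pow
    (hX : ∀ i, ∃ a ∈ varIdeal σ K, X i - φ a ∈ varIdeal σ K ^ 2) (k : ℕ)
    (b : MvPowerSeries σ K) : ∃ a, b - φ a ∈ varIdeal σ K ^ k := by
  induction k with
  | zero => simp
  | succ k ih =>
    obtain ⟨a, ha⟩ := ih
    obtain ⟨a', -, ha'⟩ := exists_sub_algHom_mem_pow_succ hX k _ ha
    exact ⟨a + a', by rw [map_add, ← sub_sub]; exact ha'⟩

/-- A surjective endomorphism of the finite-dimensional space `R/𝔪^k` is injective. -/
theorem mem_pow_of_algHom_mem_pow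
    (hX : ∀ i, ∃ a ∈ varIdeal σ K, X i - φ a ∈ varIdeal σ K ^ 2) (k : ℕ)
    (b : MvPowerSeries σ K) (hb : φ b ∈ varIdeal σ K ^ k) : b ∈ varIdeal σ K ^ k := by
  have := finite_quotient_varIdeal_pow (K := K) (σ := σ) k
  let P := (varIdeal σ K ^ k).restrictScalars K
  let q : (MvPowerSeries σ K ⧸ P) →ₗ[K] (MvPowerSeries σ K ⧸ P) :=
    P.mapQ P φ.toLinearMap fun a ha => algHom_mem_varIdeal_pow φ ha
  have hq : Function.Surjective q := by
    intro x
    obtain ⟨b, rfl⟩ := Submodule.Quotient.mk_surjective _ x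
    obtain ⟨a, ha⟩ := exists_sub_algHom_mem_pow hX k b
    exact ⟨Submodule.Quotient.mk a, ((Submodule.Quotient.eq P).mpr ha).symm⟩
  have hinj := IsNoetherian.injective_of_surjective_endomorphism q hq
  have h0 : q (Submodule.Quotient.mk b) = 0 := (Submodule.Quotient.mk_eq_zero P).mpr hb
  exact (Submodule.Quotient.mk_eq_zero P).mp ((map_eq_zero_iff q hinj).mp h0)

/-- Replaces the ideal generated by `φ(J)` by the set `φ(J)` modulo `𝔪^k`. It serves twice: for `k =
2` before surjectivity is known, and for all `k` afterwards. -/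
theorem exists_sub_algHom_mem_of_mem_map {σ : Type*}
    {φ : MvPowerSeries σ K →ₐ[K] MvPowerSeries σ K} {J : Ideal (MvPowerSeries σ K)} {k : ℕ}
    (hJ : ∀ r, ∀ x ∈ J, ∃ a ∈ J, r * φ x - φ a ∈ varIdeal σ K ^ k)
    {b : MvPowerSeries σ K} (hb : b ∈ J.map φ) : ∃ a ∈ J, b - φ a ∈ varIdeal σ K ^ k := by
  induction hb using Submodule.closure_induction with
  | zero => exact ⟨0, zero_mem _, by simp⟩
  | add x y _ _ hx hy =>
    obtain ⟨a, ha, h⟩ := hx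
    obtain ⟨a', ha', h'⟩ := hy
    exact ⟨a + a', add_mem ha ha', by rw [map_add, add_sub_add_comm]; exact add_mem h h'⟩
  | smul_mem r x hx =>
    obtain ⟨x, hx, rfl⟩ := hx
    exact hJ r x hx

theorem exists_X_sub_algHom_mem_sq {V : Submodule K (MvPowerSeries σ K)}
    {J : Ideal (MvPowerSeries σ K)} (hJ : J ≤ varIdeal σ K) (i : σ)
    (hi : X i ∈ V.map φ.toLinearMap ⊔ (J.map φ).restrictScalars K) :
    ∃ a ∈ varIdeal σ K, X i - φ a ∈ varIdeal σ K ^ 2 := by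
  obtain ⟨_, ⟨v, -, rfl⟩, w, hw, hvw⟩ := Submodule.mem_sup.mp hi
  -- Since `φ(J) ⊆ 𝔪`, a multiplier `r` may be replaced by its constant term modulo `𝔪²`.
  obtain ⟨a, ha, hwa⟩ := exists_sub_algHom_mem_of_mem_map (k := 2) (fun r x hx => by
    refine ⟨constantCoeff r • x, Submodule.smul_of_tower_mem _ _ hx, ?_⟩
    have := Ideal.mul_mem_mul (sub_algebraMap_constantCoeff_mem r) (algHom_mem_varIdeal φ (hJ hx))
    rw [← pow_two] at this
    rwa [map_smul, Algebra.smul_def, ← sub_mul]) hw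
  have hv := sub_algebraMap_constantCoeff_mem v
  have hva := add_mem hv (hJ ha)
  have hXi : (X i : MvPowerSeries σ K) ∈ varIdeal σ K := Ideal.subset_span ⟨i, rfl⟩
  have heq : X i - φ (v - algebraMap K _ (constantCoeff v) + a) =
      algebraMap K _ (constantCoeff v) + (w - φ a) := by
    rw [← hvw, map_add, map_sub, AlgHom.commutes, AlgHom.toLinearMap_apply]
    ring
  -- In `heq` every term except the constant of `v` lies in `𝔪`, so that constant is zero.
  have hc : algebraMap K (MvPowerSeries σ K) (constantCoeff v) ∈ varIdeal σ K := by
    rw [eq_sub_of_add_eq heq.symm]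
    exact sub_mem (sub_mem hXi (algHom_mem_varIdeal φ hva)) (Ideal.pow_le_self two_ne_zero hwa)
  rw [mem_varIdeal_iff, MvPowerSeries.algebraMap_apply] at hc
  refine ⟨_, hva, ?_⟩
  rw [heq]
  simp only [Algebra.algebraMap_self, RingHom.id_apply, constantCoeff_C] at hc
  rw [hc]
  simpa using hwa

/-- Degrees `< k` approximate `φ b` modulo `𝔪^k`; the bound `k + 2` also includes the variables when
`k = 0`. Injectivity modulo `𝔪^k` carries the decomposition of `φ b` back to `b`. -/
theorem mem_sup_varIdeal_pow {V : Submodule K (MvPowerSeries σ K)}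
    {J : Ideal (MvPowerSeries σ K)} (hJ : J ≤ varIdeal σ K) (k : ℕ)
    (hmon : ∀ d : σ →₀ ℕ, d.degree < k + 2 →
      monomial d (1 : K) ∈ V.map φ.toLinearMap ⊔ (J.map φ).restrictScalars K)
    (b : MvPowerSeries σ K) :
    b ∈ V ⊔ (J ⊔ varIdeal σ K ^ k).restrictScalars K := by
  have hX : ∀ i, ∃ a ∈ varIdeal σ K, X i - φ a ∈ varIdeal σ K ^ 2 := fun i =>
    exists_X_sub_algHom_mem_sq hJ i (hmon _ (by simp))
  obtain ⟨g, hg, hbg⟩ := mem_sup_varIdeal_pow_of_monomial_mem _ k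
    (fun d hd => hmon d (by omega)) (φ b)
  obtain ⟨_, ⟨v, hv, rfl⟩, w, hw, rfl⟩ := Submodule.mem_sup.mp hg
  obtain ⟨a, ha, hwa⟩ := exists_sub_algHom_mem_of_mem_map (k := k) (fun r x hx => by
    obtain ⟨r', hr'⟩ := exists_sub_algHom_mem_pow hX k r
    refine ⟨r' * x, Ideal.mul_mem_left _ _ hx, ?_⟩
    rw [map_mul, ← sub_mul]
    exact Ideal.mul_mem_right _ _ hr') hw
  have hmem : b - v - a ∈ varIdeal σ K ^ k := by
    refine mem_pow_of_algHom_mem_pow hX k _ ?_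
    convert add_mem hbg hwa using 1
    simp only [map_sub, AlgHom.toLinearMap_apply]
    ring
  refine Submodule.mem_sup.mpr ⟨v, hv, b - v, ?_, by ring⟩
  rw [Submodule.restrictScalars_mem]
  exact Submodule.mem_sup.mpr ⟨a, ha, b - v - a, hmem, by ring⟩

/-- A finite-dimensional complement modulo every power of the maximal ideal is a complement. -/
theorem sup_eq_top_of_forall_sup_pow_eq_top (V : Submodule K (MvPowerSeries σ K))
    [FiniteDimensional K V] (J : Ideal (MvPowerSeries σ K))
    (h : ∀ k b, b ∈ V ⊔ (J ⊔ varIdeal σ K ^ k).restrictScalars K) (b : MvPowerSeries σ K) :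
    b ∈ V ⊔ J.restrictScalars K := by
  have hanti : ∀ {j k : ℕ}, j ≤ k → J ⊔ varIdeal σ K ^ k ≤ J ⊔ varIdeal σ K ^ j :=
    fun hjk => sup_le_sup_left (Ideal.pow_le_pow_right hjk) J
  -- The decreasing subspaces `V ∩ (J + 𝔪^k)` of the finite-dimensional `V` stabilise.
  let A : ℕ →o (Submodule K V)ᵒᵈ :=
    ⟨fun k => OrderDual.toDual
      (((J ⊔ varIdeal σ K ^ k).restrictScalars K).comap V.subtype),
      fun j k hjk x hx => hanti hjk hx⟩
  obtain ⟨k, hk⟩ := IsArtinian.monotone_stabilizes A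
  -- At the stable index, the `V`-component of an element of `𝔪^k` lies in `J + 𝔪^k`, hence in `J +
  -- 𝔪^(k+1)`. Nakayama's lemma turns this into `𝔪^k ⊆ J`.
  have hle : varIdeal σ K ^ k ≤ J ⊔ varIdeal σ K • varIdeal σ K ^ k := by
    intro a ha
    rw [smul_eq_mul, ← pow_succ']
    obtain ⟨v, hv, w, hw, rfl⟩ := Submodule.mem_sup.mp (h (k + 1) a)
    refine add_mem ?_ hw
    have hvk : (⟨v, hv⟩ : V) ∈ OrderDual.ofDual (A k) := by
      change v ∈ J ⊔ varIdeal σ K ^ k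
      rw [← add_sub_cancel_right v w]
      exact sub_mem (Submodule.mem_sup_right ha) (hanti (Nat.le_succ k) hw)
    rw [hk (k + 1) (Nat.le_succ k)] at hvk
    exact hvk
  have hpow : varIdeal σ K ^ k ≤ J :=
    Submodule.le_of_le_smul_of_le_jacobson_bot (IsNoetherian.noetherian _)
      (IsAdicComplete.le_jacobson_bot _) hle
  have := h k b
  rwa [sup_eq_left.mpr hpow] at this

end Endomorphism

/-! ### Necessity: conclusion -/

section Versal

variable {n m : ℕ} {f : MvPowerSeries (Fin n) K} {F : MvPowerSeries (Fin n ⊕ Fin m) K}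

theorem span_eq_top_of_isVersal (h : IsVersal F f) :
    Submodule.span K (Set.range fun i : Fin m =>
      (Ideal.Quotient.mk (jacobianIdeal f) (initialVelocity F i))) = ⊤ := by
  rw [eq_top_iff]
  rintro x -
  obtain ⟨b, rfl⟩ := Ideal.Quotient.mk_surjective x
  -- If `J = R` the quotient is zero; otherwise `J ⊆ 𝔪`, as the cotangent argument requires.
  by_cases hJ : jacobianIdeal f = ⊤
  · have : Ideal.Quotient.mk (jacobianIdeal f) b = 0 :=
      Ideal.Quotient.eq_zero_iff_mem.mpr (hJ ▸ Submodule.mem_top)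
    rw [this]
    exact zero_mem _
  replace hJ : jacobianIdeal f ≤ varIdeal (Fin n) K := by
    rw [varIdeal_eq_maximalIdeal]
    exact IsLocalRing.le_maximalIdeal hJ
  have : FiniteDimensional K (velocitySpan F) :=
    FiniteDimensional.span_of_finite K (Set.finite_range _)
  have hb := sup_eq_top_of_forall_sup_pow_eq_top (velocitySpan F) (jacobianIdeal f)
    (fun k => by
      -- Each `k` needs its own test deformation with finitely many parameters, so `φ` varies with
      -- `k` while `V` and `J` do not.
      let s := (Finsupp.finite_of_degree_lt (σ := Fin n) (k + 2)).toFinset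
      let g : Fin s.card → MvPowerSeries (Fin n) K := fun a => monomial (s.equivFin.symm a).1 1
      obtain ⟨φ, hφ⟩ := exists_initialVelocity_mem_of_isInducedFrom h.1
        (h.2 s.card (linearDeformation f g) (isDeformation_linearDeformation g))
      refine mem_sup_varIdeal_pow (φ := φ) hJ k fun d hd => ?_
      have := hφ (s.equivFin ⟨d, by simpa [s] using hd⟩)
      rw [initialVelocity_linearDeformation] at this
      simpa [g] using this) b
  obtain ⟨v, hv, w, hw, rfl⟩ := Submodule.mem_sup.mp hb
  rw [map_add, Ideal.Quotient.eq_zero_iff_mem.mpr hw, add_zero]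
  have := Submodule.mem_map_of_mem (f := (Ideal.Quotient.mkₐ K (jacobianIdeal f)).toLinearMap) hv
  rw [Submodule.map_span, ← Set.range_comp] at this
  exact this

end Versal

end FormalDeformation

theorem mainTheorem8 {K : Type*} [Field K] [CharZero K] {n m : ℕ}
    (f : MvPowerSeries (Fin n) K) (F : MvPowerSeries (Fin n ⊕ Fin m) K)
    (hF : FormalDeformation.IsDeformation F f) :
    FormalDeformation.IsVersal F f ↔
      Submodule.span K (Set.range fun i : Fin m =>
        (Ideal.Quotient.mk (FormalDeformation.jacobianIdeal f)
          (FormalDeformation.initialVelocity F i))) = ⊤ :=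
  ⟨FormalDeformation.span_eq_top_of_isVersal, fun hspan =>
    ⟨hF, fun _ G hG => FormalDeformation.isInducedFrom_of_span_eq_top hspan hF G hG⟩⟩
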